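/- Let $\mu$ be a measure on a measurable space $\Omega$, and let $f_0,f_1$ be probability densities with respect to $\mu$ that are positive $\mu$-a.e.; put $l=f_1/f_0$. Let $\alpha\in\mathbb R\setminus\{0,1\}$ and $\varepsilon_0,\varepsilon_1>0$. For $j\in\{0,1\}$ let $\mathscr G_j$ be the set of all $\mu$-a.e. positive probability densities $g$ with $D_\alpha(g,f_j)\le\varepsilon_j$, where $$D_\alpha(g,f)=\frac1{\alpha(1-\alpha)}\int_\Omega\big((1-\alpha)f+\alpha g-g^\alpha f^{1-\alpha}\big)\,d\mu\in[0,\infty],$$ and for $u\in(0,1)$ let $D_u(g_0,g_1)=\int_\Omega g_1^{u}g_0^{1-u}\,d\mu$. Say that $(\hat g_0,\hat g_1)$ solves the maximization problem at $u$ if $\hat g_0\in\mathscr G_0$ maximizes $D_u(\cdot,\hat g_1)$ over $\mathscr G_0$ and $\hat g_1\in\mathscr G_1$ maximizes $D_u(\hat g_0,\cdot)$ over $\mathscr G_1$. Say that $(\hat g_0,\hat g_1)$ are least favorable densities (of the asymptotically minimax robust Bayesian test) with exponent $u$ if, in addition, $u$ minimizes $v\mapsto D_v(\hat g_0,\hat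 g_1)$ over $(0,1)$. Let $u\in(0,1)$ and let $\hat g_0,\hat g_1$ be $\mu$-a.e. positive probability densities that are not $\mu$-a.e. equal. Write $\hat l=\hat g_1/\hat g_0$. Then: (i) $(\hat g_0,\hat g_1)$ solves the maximization problem at $u$ if and only if $D_\alpha(\hat g_0,f_0)=\varepsilon_0$, $D_\alpha(\hat g_1,f_1)=\varepsilon_1$, and there are $\lambda_0,\lambda_1>0$ and $\mu_0,\mu_1\in\mathbb R$ such that, $\mu$-a.e., the quantities $$B_0=\frac{1-\alpha}{\lambda_0}\Big(\mu_0-(1-u)\,\hat l^{\,u}\Big)+1,\qquad B_1=\frac{1-\alpha}{\lambda_1}\Big(\mu_1-u\,\hat l^{\,-1+u}\Big)+1$$ are positive and $$\hat g_0=B_0^{\frac1{\alpha-1}}f_0,\qquad \hat g_1=B_1^{\frac1{\alpha-1}}f_1,\qquad \hat l=\Big(\frac{B_1}{B_0}\Big)^{\frac1{\alpha-1}}l .$$ (ii) $(\hat g_0,\hat g_1)$ are least favorable densities with exponent $u$ if and only if the conditions of (i) hold and $u$ minimizes $v\mapsto D_v(\hat g_0,\hat g_1)$ over $(0,1)$.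 (iii) $(\hat g_0,\hat g_1)$ are least favorable densities with exponent $u$ if and only if $\hat g_0\in\mathscr G_0$, $\hat g_1\in\mathscr G_1$ and, for all $g_0\in\mathscr G_0$, $g_1\in\mathscr G_1$ and $v\in(0,1)$, $$D_u(g_0,g_1)\le D_u(\hat g_0,\hat g_1)\le D_v(\hat g_0,\hat g_1).$$ -/

import Mathlib

open MeasureTheory Set Filter

noncomputable section

/-- `g` is a probability density with respect to the reference measure `μ`, positive `μ`-almost
everywhere (on all of the common support). -/
structure IsPosDensity {Ω : Type*} [MeasurableSpace Ω] (μ : Measure Ω) (g : Ω → ℝ) : Prop where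
  measurable : Measurable g
  pos : ∀ᵐ x ∂μ, 0 < g x
  integrable : Integrable g μ
  integral_eq_one : ∫ x, g x ∂μ = 1

/-- The `u`-affinity `D_u(G₀, G₁) = ∫ g₁ ^ u g₀ ^ (1 - u) dμ` of two densities. For `u ∈ (0,1)` and
probability densities the integrand is integrable, being at most `u g₁ + (1 - u) g₀`. -/
def uAffinity {Ω : Type*} [MeasurableSpace Ω] (μ : Measure Ω) (u : ℝ) (g₀ g₁ : Ω → ℝ) : ℝ :=
  ∫ x, g₁ x ^ u * g₀ x ^ (1 - u) ∂μ

/-- The integrand of the `α`-divergence, at the values `g`, `f` of the two densities. -/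
def alphaDivIntegrand (α g f : ℝ) : ℝ :=
  1 / (α * (1 - α)) * ((1 - α) * f + α * g - g ^ α * f ^ (1 - α))

theorem alphaDivIntegrand_nonneg_of_pos {α g f : ℝ} (h0 : 0 < α) (h1 : α ≠ 1) (hg : 0 < g)
    (hf : 0 < f) :
    0 ≤ alphaDivIntegrand α g f := by
  have hx : 0 < g / f := div_pos hg hf
  have key : (1 - α) * f + α * g - g ^ α * f ^ (1 - α)
      = f * (1 + α * (g / f - 1) - (1 + (g / f - 1)) ^ α) := by
    have e : (1 + (g / f - 1)) = g / f := by ring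
    rw [e, Real.div_rpow hg.le hf.le, Real.rpow_sub hf, Real.rpow_one]
    have := (Real.rpow_pos_of_pos hf α).ne'
    field_simp
    ring
  unfold alphaDivIntegrand
  rw [key]
  have hs : -1 ≤ g / f - 1 := by linarith
  rcases lt_or_gt_of_ne h1 with h' | h'
  · have b := rpow_one_add_le_one_add_mul_self hs h0.le h'.le
    exact mul_nonneg (one_div_nonneg.2 (mul_nonneg h0.le (by linarith)))
      (mul_nonneg hf.le (by linarith))
  · have b := one_add_mul_self_le_rpow_one_add hs h'.le
    refine mul_nonneg_of_nonpos_of_nonpos ?_ (mul_nonpos_of_nonneg_of_nonpos hf.le (by linarith))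
    exact one_div_nonpos.2 (mul_nonpos_of_nonneg_of_nonpos h0.le (by linarith))

/-- The integrand of the `α`-divergence is nonnegative, so that `ENNReal.ofReal` truncates nothing
in the definition of `alphaDiv`. -/
theorem alphaDivIntegrand_nonneg {α g f : ℝ} (h0 : α ≠ 0) (h1 : α ≠ 1) (hg : 0 < g) (hf : 0 < f) :
    0 ≤ alphaDivIntegrand α g f := by
  rcases lt_or_gt_of_ne h0 with h | h
  · have e : alphaDivIntegrand α g f = alphaDivIntegrand (1 - α) f g := by
      unfold alphaDivIntegrand
      rw [sub_sub_cancel]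
      ring
    rw [e]
    exact alphaDivIntegrand_nonneg_of_pos (by linarith) (by linarith) hf hg
  · exact alphaDivIntegrand_nonneg_of_pos h h1 hg hf

/-- The `α`-divergence
`D_α(G, F) = 1 / (α (1 - α)) ∫ ((1 - α) f + α g - g ^ α f ^ (1 - α)) dμ ∈ [0, ∞]`. -/
def alphaDiv {Ω : Type*} [MeasurableSpace Ω] (μ : Measure Ω) (α : ℝ) (g f : Ω → ℝ) : ENNReal :=
  ∫⁻ x, ENNReal.ofReal (alphaDivIntegrand α (g x) (f x)) ∂μ

/-- The `α`-divergence uncertainty class of radius `ε` around the nominal density `f`: all positive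
probability densities `g` with `D_α(G, F) ≤ ε`. -/
def alphaClass {Ω : Type*} [MeasurableSpace Ω] (μ : Measure Ω) (α ε : ℝ) (f : Ω → ℝ) :
    Set (Ω → ℝ) :=
  {g | IsPosDensity μ g ∧ alphaDiv μ α g f ≤ ENNReal.ofReal ε}

/-- The coupled maximization problems at a fixed `u`: over its own class, `ĝ₀` maximizes
`D_u(·, Ĝ₁)` and `ĝ₁` maximizes `D_u(Ĝ₀, ·)`. -/
structure SolvesMaximization {Ω : Type*} [MeasurableSpace Ω] (μ : Measure Ω)
    (C₀ C₁ : Set (Ω → ℝ)) (u : ℝ) (g₀ g₁ : Ω → ℝ) : Prop where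
  mem₀ : g₀ ∈ C₀
  mem₁ : g₁ ∈ C₁
  max₀ : ∀ h ∈ C₀, uAffinity μ u h g₁ ≤ uAffinity μ u g₀ g₁
  max₁ : ∀ h ∈ C₁, uAffinity μ u g₀ h ≤ uAffinity μ u g₀ g₁

/-- `u` minimizes `v ↦ D_v(G₀, G₁)` over `(0, 1)`. -/
def MinimizesAffinity {Ω : Type*} [MeasurableSpace Ω] (μ : Measure Ω) (u : ℝ) (g₀ g₁ : Ω → ℝ) :
    Prop :=
  u ∈ Ioo (0 : ℝ) 1 ∧ ∀ v ∈ Ioo (0 : ℝ) 1, uAffinity μ u g₀ g₁ ≤ uAffinity μ v g₀ g₁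

/-- `ĝ₀, ĝ₁` are least favorable densities, with minimizing exponent `u`, for the asymptotically
minimax robust Bayesian test between the classes `C₀` and `C₁`: they solve the maximization
problems at `u`, and `u` minimizes the affinity of `ĝ₀, ĝ₁`. -/
structure IsLeastFavorable {Ω : Type*} [MeasurableSpace Ω] (μ : Measure Ω)
    (C₀ C₁ : Set (Ω → ℝ)) (u : ℝ) (g₀ g₁ : Ω → ℝ) : Prop where
  maximization : SolvesMaximization μ C₀ C₁ u g₀ g₁
  minimization : MinimizesAffinity μ u g₀ g₁

/-- The saddle point condition `D_û(G₀, G₁) ≤ D_û(Ĝ₀, Ĝ₁) ≤ D_u(Ĝ₀, Ĝ₁)`, with joint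
maximization over the pair `(G₀, G₁)`. -/
structure IsAffinitySaddle {Ω : Type*} [MeasurableSpace Ω] (μ : Measure Ω)
    (C₀ C₁ : Set (Ω → ℝ)) (u : ℝ) (g₀ g₁ : Ω → ℝ) : Prop where
  mem₀ : g₀ ∈ C₀
  mem₁ : g₁ ∈ C₁
  max : ∀ h₀ ∈ C₀, ∀ h₁ ∈ C₁, uAffinity μ u h₀ h₁ ≤ uAffinity μ u g₀ g₁
  min : MinimizesAffinity μ u g₀ g₁

/-- The affine expression in `r ^ u` whose power gives `ĝ₀ / f₀`; `r` is the value of `ĝ₁ / ĝ₀`. -/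
def lfdBase₀ (α u lam m r : ℝ) : ℝ :=
  (1 - α) / lam * (m - (1 - u) * r ^ u) + 1

/-- The affine expression in `r ^ (-1 + u)` whose power gives `ĝ₁ / f₁`; `r` is the value of
`ĝ₁ / ĝ₀`. -/
def lfdBase₁ (α u lam m r : ℝ) : ℝ :=
  (1 - α) / lam * (m - u * r ^ (-1 + u)) + 1

/-- The parametric form of the least favorable densities with multipliers `lam₀, lam₁, m₀, m₁`,
together with the implicit equation for the robust likelihood ratio. The bases of the powers are
required to be positive, so that the real powers are genuine ones. -/
structure HasLFDForm {Ω : Type*} [MeasurableSpace Ω] (μ : Measure Ω) (f₀ f₁ : Ω → ℝ)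
    (α u lam₀ lam₁ m₀ m₁ : ℝ) (g₀ g₁ : Ω → ℝ) : Prop where
  lam₀_pos : 0 < lam₀
  lam₁_pos : 0 < lam₁
  base₀_pos : ∀ᵐ x ∂μ, 0 < lfdBase₀ α u lam₀ m₀ (g₁ x / g₀ x)
  base₁_pos : ∀ᵐ x ∂μ, 0 < lfdBase₁ α u lam₁ m₁ (g₁ x / g₀ x)
  density₀ : ∀ᵐ x ∂μ, g₀ x = lfdBase₀ α u lam₀ m₀ (g₁ x / g₀ x) ^ (1 / (α - 1)) * f₀ x
  density₁ : ∀ᵐ x ∂μ, g₁ x = lfdBase₁ α u lam₁ m₁ (g₁ x / g₀ x) ^ (1 / (α - 1)) * f₁ x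
  ratio : ∀ᵐ x ∂μ, g₁ x / g₀ x =
    (lfdBase₁ α u lam₁ m₁ (g₁ x / g₀ x) / lfdBase₀ α u lam₀ m₀ (g₁ x / g₀ x)) ^ (1 / (α - 1))
      * (f₁ x / f₀ x)

end

/-!
The conditions on `ĝ₀`, `ĝ₁` are the Karush-Kuhn-Tucker conditions of a concave maximization
problem over convex divergence balls. The proof works with the slope
`(1 - (g / f) ^ (α - 1)) / (1 - α)` of the divergence integrand (`alphaDivSlope`). In terms of it,
the parametric form of `ĝ₀` says that the slope `(1 - u) l̂ ^ u` of the affinity is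
`m₀ + lam₀ * alphaDivSlope α ĝ₀ f₀` (`stationary_iff_lfdBase₀_eq`), and the form of `ĝ₁` is the
same statement with the two densities exchanged and `u` replaced by `1 - u`
(`exists_hasLFDForm_iff`).

*Sufficiency.* By weighted AM-GM the affinity integrand lies below its supporting plane along the
ray `g₁ / g₀ = l̂` (`rpow_mul_rpow_le_tangent`). This plane is a sum of a function of `g₀` and a
function of `g₁`; by stationarity and convexity of the divergence
(`alphaDivIntegrand_sub_tangent`), each of the two has its largest integral over the class at the
stationary density (`integral_tangent_le_of_stationary`). Both densities may vary at once, so that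
one gets the joint maximization of the saddle point condition as well
(`uAffinity_le_of_stationary`).

*Necessity.* For one density, `ĝ₀` is perturbed to `ĝ₀ (1 + t k)`, where `k` has mean zero under
`ĝ₀`, and `k` and its products with the two slopes are bounded. Such densities remain positive, and
the tangent inequalities with slopes taken at the perturbed point, together with dominated
convergence, give the first-order condition (`integral_ratio_testFunction_nonpos`) without
differentiating an integral. The class of these `k` is rich enough for a multiplier rule
(`exists_affine_of_integral_testFunction_nonpos`). Degenerate cases are excluded because a constant
slope of the affinity forces `ĝ₀ = ĝ₁`, and a constant slope of the divergence forces `ĝ₀ = f₀`;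
so the constraint is active and its multiplier positive
(`exists_stationary_of_forall_uAffinity_le`).
-/

open scoped Topology

/-! ### Pointwise convexity inequalities -/

/-- The derivative in `g` of `alphaDivIntegrand α g f`. -/
noncomputable def alphaDivSlope (α g f : ℝ) : ℝ :=
  (1 - (g / f) ^ (α - 1)) / (1 - α)

/-- The error of the tangent line to `alphaDivIntegrand α · f` at `g` is again an `α`-divergence
integrand, up to a positive factor; this is convexity of the divergence in its first argument. -/
theorem alphaDivIntegrand_sub_tangent {α g h f : ℝ} (h0 : α ≠ 0) (h1 : α ≠ 1)
    (hg : 0 < g) (hf : 0 < f) :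
    alphaDivIntegrand α h f - alphaDivIntegrand α g f - alphaDivSlope α g f * (h - g)
      = (g / f) ^ (α - 1) * alphaDivIntegrand α h g := by
  have h1' : 1 - α ≠ 0 := sub_ne_zero.2 h1.symm
  unfold alphaDivSlope alphaDivIntegrand
  rw [Real.div_rpow hg.le hf.le, Real.rpow_sub hf, Real.rpow_sub hg, Real.rpow_sub hf,
    Real.rpow_sub hg, Real.rpow_one, Real.rpow_one]
  have := (Real.rpow_pos_of_pos hf α).ne'
  have := (Real.rpow_pos_of_pos hg α).ne'
  field_simp
  ring

theorem alphaDivIntegrand_tangent_le {α g h f : ℝ} (h0 : α ≠ 0) (h1 : α ≠ 1)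
    (hg : 0 < g) (hh : 0 < h) (hf : 0 < f) :
    alphaDivSlope α g f * (h - g) ≤ alphaDivIntegrand α h f - alphaDivIntegrand α g f := by
  have := alphaDivIntegrand_sub_tangent (h := h) h0 h1 hg hf
  have := mul_nonneg (Real.rpow_nonneg (div_pos hg hf).le (α - 1))
    (alphaDivIntegrand_nonneg h0 h1 hh hg)
  linarith

theorem alphaDivIntegrand_self {α f : ℝ} (hf : 0 < f) : alphaDivIntegrand α f f = 0 := by
  unfold alphaDivIntegrand
  rw [← Real.rpow_add hf, add_sub_cancel, Real.rpow_one]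
  ring

/-- The stationarity condition for one density is the defining equation of the base of its power
form. -/
theorem stationary_iff_lfdBase₀_eq {α u lam m r g f : ℝ} (h1 : α ≠ 1) (hlam : 0 < lam) :
    (1 - u) * r ^ u = m + lam * alphaDivSlope α g f ↔
      lfdBase₀ α u lam m r = (g / f) ^ (α - 1) := by
  have h1' : 1 - α ≠ 0 := sub_ne_zero.2 h1.symm
  have e : lfdBase₀ α u lam m r - (g / f) ^ (α - 1)
      = (1 - α) / lam * (m + lam * alphaDivSlope α g f - (1 - u) * r ^ u) := by
    unfold lfdBase₀ alphaDivSlope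
    field_simp
    ring
  rw [← sub_eq_zero (a := lfdBase₀ α u lam m r), e, mul_eq_zero, sub_eq_zero,
    or_iff_right (div_ne_zero h1' hlam.ne'), eq_comm]

theorem div_rpow_neg_one_add {u x y : ℝ} (hx : 0 < x) (hy : 0 < y) :
    (y / x) ^ (-1 + u) = (x / y) ^ (1 - u) := by
  rw [show -1 + u = -(1 - u) by ring, Real.rpow_neg (div_pos hy hx).le,
    ← Real.inv_rpow (div_pos hy hx).le, inv_div]

/-- Exchanging the two densities and replacing `u` by `1 - u` turns the second base into the
first. -/
theorem lfdBase₁_eq_lfdBase₀ {α u lam m x y : ℝ} (hx : 0 < x) (hy : 0 < y) :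
    lfdBase₁ α u lam m (y / x) = lfdBase₀ α (1 - u) lam m (x / y) := by
  unfold lfdBase₁ lfdBase₀
  rw [div_rpow_neg_one_add hx hy, sub_sub_cancel]

theorem eq_rpow_mul_iff {α B g f : ℝ} (h1 : α ≠ 1) (hB : 0 < B) (hg : 0 < g) (hf : 0 < f) :
    g = B ^ (1 / (α - 1)) * f ↔ B = (g / f) ^ (α - 1) := by
  have h1' : α - 1 ≠ 0 := sub_ne_zero.2 h1
  rw [← div_eq_iff hf.ne', one_div, Real.eq_rpow_inv (div_pos hg hf).le hB.le h1', eq_comm]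

/-- The affinity integrand lies below its supporting planes; `r` is the slope of the ray of
contact. -/
theorem rpow_mul_rpow_le_tangent {u x y r : ℝ} (hu : u ∈ Ioo (0 : ℝ) 1) (hx : 0 ≤ x) (hy : 0 ≤ y)
    (hr : 0 < r) :
    y ^ u * x ^ (1 - u) ≤ (1 - u) * r ^ u * x + u * r ^ (-1 + u) * y := by
  have key := Real.geom_mean_le_arith_mean2_weighted hu.1.le (sub_nonneg.2 hu.2.le)
    (mul_nonneg (Real.rpow_nonneg hr.le (-1 + u)) hy)
    (mul_nonneg (Real.rpow_nonneg hr.le u) hx) (by ring)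
  have e : (r ^ (-1 + u) * y) ^ u * (r ^ u * x) ^ (1 - u) = y ^ u * x ^ (1 - u) := by
    rw [Real.mul_rpow (Real.rpow_nonneg hr.le _) hy, Real.mul_rpow (Real.rpow_nonneg hr.le _) hx,
      ← Real.rpow_mul hr.le, ← Real.rpow_mul hr.le, mul_mul_mul_comm, ← Real.rpow_add hr,
      show (-1 + u) * u + u * (1 - u) = 0 by ring, Real.rpow_zero, one_mul]
  rw [e] at key
  linarith

/-- Tangent inequality for the concave power `y ↦ y ^ (1 - u)`, with the slope taken at `y`. -/
theorem one_add_mul_rpow_neg_le {u y : ℝ} (hu : u ∈ Ioo (0 : ℝ) 1) (hy : 0 < y) :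
    1 + (1 - u) * (y - 1) * y ^ (-u) ≤ y ^ (1 - u) := by
  have key := rpow_mul_rpow_le_tangent hu zero_le_one hy.le one_pos
  simp only [Real.one_rpow, mul_one] at key
  have hp := Real.rpow_pos_of_pos hy u
  rw [Real.rpow_sub hy, Real.rpow_neg hy.le, Real.rpow_one, ← div_eq_mul_inv, ← sub_nonneg]
  have : y / y ^ u - (1 + (1 - u) * (y - 1) / y ^ u)
      = ((1 - u + u * y) - y ^ u) / y ^ u := by
    field_simp
    ring
  rw [this]
  exact div_nonneg (by linarith) hp.le

/-- The affinity integrand in terms of the likelihood ratio. -/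
theorem rpow_mul_rpow_eq_div_rpow_mul {u x y : ℝ} (hx : 0 < x) (hy : 0 < y) :
    y ^ u * x ^ (1 - u) = (y / x) ^ u * x := by
  rw [Real.div_rpow hy.le hx.le, Real.rpow_sub hx, Real.rpow_one]
  ring

/-! ### Affinities and divergences of densities -/

section

variable {Ω : Type*} [MeasurableSpace Ω] {μ : Measure Ω}

theorem uAffinity_swap (u : ℝ) (g₀ g₁ : Ω → ℝ) :
    uAffinity μ (1 - u) g₁ g₀ = uAffinity μ u g₀ g₁ := by
  unfold uAffinity
  simp only [sub_sub_cancel, mul_comm]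

theorem IsPosDensity.integrable_affinity {u : ℝ} (hu : u ∈ Ioo (0 : ℝ) 1) {g₀ g₁ : Ω → ℝ}
    (h₀ : IsPosDensity μ g₀) (h₁ : IsPosDensity μ g₁) :
    Integrable (fun x => g₁ x ^ u * g₀ x ^ (1 - u)) μ := by
  refine ((h₀.integrable.const_mul (1 - u)).add (h₁.integrable.const_mul u)).mono'
    ((h₁.measurable.pow_const _).mul (h₀.measurable.pow_const _)).aestronglyMeasurable ?_
  filter_upwards [h₀.pos, h₁.pos] with x hx hy
  have := rpow_mul_rpow_le_tangent hu hx.le hy.le one_pos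
  simp only [Real.one_rpow, mul_one] at this
  rw [Real.norm_of_nonneg (by positivity)]
  exact this

theorem IsPosDensity.integrable_div_rpow_mul {u : ℝ} (hu : u ∈ Ioo (0 : ℝ) 1) {g₀ g₁ : Ω → ℝ}
    (h₀ : IsPosDensity μ g₀) (h₁ : IsPosDensity μ g₁) :
    Integrable (fun x => (g₁ x / g₀ x) ^ u * g₀ x) μ := by
  refine (h₀.integrable_affinity hu h₁).congr ?_
  filter_upwards [h₀.pos, h₁.pos] with x hx hy
  exact rpow_mul_rpow_eq_div_rpow_mul hx hy

theorem IsPosDensity.uAffinity_eq_integral {u : ℝ} {g₀ g₁ : Ω → ℝ}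
    (h₀ : IsPosDensity μ g₀) (h₁ : IsPosDensity μ g₁) :
    uAffinity μ u g₀ g₁ = ∫ x, (g₁ x / g₀ x) ^ u * g₀ x ∂μ := by
  refine integral_congr_ae ?_
  filter_upwards [h₀.pos, h₁.pos] with x hx hy
  exact rpow_mul_rpow_eq_div_rpow_mul hx hy

/-- Proportional densities agree, both having integral one. -/
theorem IsPosDensity.ae_eq_of_ae_eq_const_mul {g h : Ω → ℝ} (hg : IsPosDensity μ g)
    (hh : IsPosDensity μ h) {c : ℝ} (hc : ∀ᵐ x ∂μ, h x = c * g x) : h =ᵐ[μ] g := by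
  have e := integral_congr_ae hc
  rw [hh.integral_eq_one, integral_const_mul, hg.integral_eq_one, mul_one] at e
  filter_upwards [hc] with x hx
  rw [hx, ← e, one_mul]

theorem IsPosDensity.ae_eq_of_div_rpow_ae_eq_const {g h : Ω → ℝ} (hg : IsPosDensity μ g)
    (hh : IsPosDensity μ h) {p c : ℝ} (hp : p ≠ 0) (hc : ∀ᵐ x ∂μ, (h x / g x) ^ p = c) :
    h =ᵐ[μ] g := by
  refine hg.ae_eq_of_ae_eq_const_mul hh (c := c ^ p⁻¹) ?_
  filter_upwards [hc, hg.pos, hh.pos] with x hx h1 h2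
  rw [← hx, Real.rpow_rpow_inv (div_pos h2 h1).le hp, div_mul_cancel₀ _ h1.ne']

theorem IsPosDensity.integrable_alphaDivIntegrand {α : ℝ} (h0 : α ≠ 0) (h1 : α ≠ 1)
    {g f : Ω → ℝ} (hg : IsPosDensity μ g) (hf : IsPosDensity μ f) (hfin : alphaDiv μ α g f ≠ ⊤) :
    Integrable (fun x => alphaDivIntegrand α (g x) (f x)) μ := by
  have hm : Measurable fun x => alphaDivIntegrand α (g x) (f x) :=
    (((hf.measurable.const_mul _).add (hg.measurable.const_mul _)).sub
      ((hg.measurable.pow_const _).mul (hf.measurable.pow_const _))).const_mul _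
  refine (lintegral_ofReal_ne_top_iff_integrable hm.aestronglyMeasurable ?_).1 hfin
  filter_upwards [hg.pos, hf.pos] with x hx hy
  exact alphaDivIntegrand_nonneg h0 h1 hx hy

theorem IsPosDensity.alphaDiv_eq_ofReal_integral {α : ℝ} (h0 : α ≠ 0) (h1 : α ≠ 1)
    {g f : Ω → ℝ} (hg : IsPosDensity μ g) (hf : IsPosDensity μ f) (hfin : alphaDiv μ α g f ≠ ⊤) :
    alphaDiv μ α g f = ENNReal.ofReal (∫ x, alphaDivIntegrand α (g x) (f x) ∂μ) := by
  refine (ofReal_integral_eq_lintegral_ofReal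
    (hg.integrable_alphaDivIntegrand h0 h1 hf hfin) ?_).symm
  filter_upwards [hg.pos, hf.pos] with x hx hy
  exact alphaDivIntegrand_nonneg h0 h1 hx hy

/-! ### Sufficiency of the multiplier conditions for one density -/

/-- Lagrangian sufficiency for one density: a stationary density that exhausts the divergence
budget maximizes the linear functional `h ↦ ∫ (1 - u) (g₁ / g₀) ^ u h dμ` over its class. -/
theorem integral_tangent_le_of_stationary {α ε u lam m : ℝ} (h0 : α ≠ 0) (h1 : α ≠ 1)
    (hu : u ∈ Ioo (0 : ℝ) 1) (hlam : 0 < lam) {f g₀ g₁ h : Ω → ℝ}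
    (hf : IsPosDensity μ f) (hg₀ : IsPosDensity μ g₀) (hg₁ : IsPosDensity μ g₁)
    (hst : ∀ᵐ x ∂μ, (1 - u) * (g₁ x / g₀ x) ^ u = m + lam * alphaDivSlope α (g₀ x) (f x))
    (hdiv : alphaDiv μ α g₀ f = ENNReal.ofReal ε) (hh : h ∈ alphaClass μ α ε f) :
    Integrable (fun x => (1 - u) * (g₁ x / g₀ x) ^ u * h x) μ ∧
      ∫ x, (1 - u) * (g₁ x / g₀ x) ^ u * h x ∂μ ≤ (1 - u) * uAffinity μ u g₀ g₁ := by
  obtain ⟨hh, hhε⟩ := hh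
  have hfin : alphaDiv μ α h f ≠ ⊤ := ne_top_of_le_ne_top ENNReal.ofReal_ne_top hhε
  have hfin₀ : alphaDiv μ α g₀ f ≠ ⊤ := hdiv ▸ ENNReal.ofReal_ne_top
  have ih := hh.integrable_alphaDivIntegrand h0 h1 hf hfin
  have ig := hg₀.integrable_alphaDivIntegrand h0 h1 hf hfin₀
  have ia := (hg₀.integrable_div_rpow_mul hu hg₁).const_mul (1 - u)
  have hle : ∫ x, alphaDivIntegrand α (h x) (f x) ∂μ
      ≤ ∫ x, alphaDivIntegrand α (g₀ x) (f x) ∂μ := by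
    rw [hh.alphaDiv_eq_ofReal_integral h0 h1 hf hfin, ← hdiv,
      hg₀.alphaDiv_eq_ofReal_integral h0 h1 hf hfin₀] at hhε
    refine (ENNReal.ofReal_le_ofReal_iff (integral_nonneg_of_ae ?_)).1 hhε
    filter_upwards [hg₀.pos, hf.pos] with x hx hy
    exact alphaDivIntegrand_nonneg h0 h1 hx hy
  have i1 : Integrable (fun x => m * (h x - g₀ x)) μ :=
    (hh.integrable.sub hg₀.integrable).const_mul m
  have i2 : Integrable (fun x => lam *
      (alphaDivIntegrand α (h x) (f x) - alphaDivIntegrand α (g₀ x) (f x))) μ :=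
    (ih.sub ig).const_mul lam
  have i3 : Integrable (fun x => (1 - u) * ((g₁ x / g₀ x) ^ u * g₀ x) + m * (h x - g₀ x)) μ :=
    ia.add i1
  have hb : ∀ᵐ x ∂μ, (1 - u) * (g₁ x / g₀ x) ^ u * h x
      ≤ (1 - u) * ((g₁ x / g₀ x) ^ u * g₀ x) + m * (h x - g₀ x)
        + lam * (alphaDivIntegrand α (h x) (f x) - alphaDivIntegrand α (g₀ x) (f x)) := by
    filter_upwards [hst, hg₀.pos, hh.pos, hf.pos] with x hx p1 p2 p3
    have := mul_le_mul_of_nonneg_left (alphaDivIntegrand_tangent_le h0 h1 p1 p2 p3) hlam.le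
    have e : (1 - u) * (g₁ x / g₀ x) ^ u * h x = (1 - u) * ((g₁ x / g₀ x) ^ u * g₀ x)
        + (1 - u) * (g₁ x / g₀ x) ^ u * (h x - g₀ x) := by ring
    rw [e, hx]
    linarith
  have iL : Integrable (fun x => (1 - u) * (g₁ x / g₀ x) ^ u * h x) μ := by
    refine (i3.add i2).mono' ((((hg₁.measurable.div hg₀.measurable).pow_const _).const_mul _).mul
      hh.measurable).aestronglyMeasurable ?_
    filter_upwards [hb, hg₀.pos, hg₁.pos, hh.pos] with x hx p1 p2 p3
    have := hu.2
    rw [Real.norm_of_nonneg (mul_nonneg (mul_nonneg (by linarith)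
      (Real.rpow_nonneg (div_pos p2 p1).le _)) p3.le)]
    exact hx
  refine ⟨iL, (integral_mono_ae iL (i3.add i2) hb).trans ?_⟩
  rw [integral_add' i3 i2, integral_add ia i1, integral_const_mul, integral_const_mul,
    integral_const_mul, integral_sub hh.integrable hg₀.integrable, integral_sub ih ig,
    hh.integral_eq_one, hg₀.integral_eq_one, hg₀.uAffinity_eq_integral hg₁]
  nlinarith

end

section

variable {Ω : Type*} [MeasurableSpace Ω] {μ : Measure Ω}

/-! ### Dominated convergence along multiplicative perturbations -/

/-- The powers `(1 + s) ^ p` are bounded for `s` near `0`, whatever the sign of `p`. -/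
theorem exists_bound_one_add_rpow (p : ℝ) :
    ∃ C : ℝ, ∀ s : ℝ, |s| ≤ 1 / 2 → ‖(1 + s) ^ p‖ ≤ C := by
  have hcont : ContinuousOn (fun s : ℝ => (1 + s) ^ p) (Icc (-(1 / 2)) (1 / 2)) := by
    refine (continuousOn_const.add continuousOn_id).rpow_const fun s hs => Or.inl ?_
    have : (0 : ℝ) < 1 + s := by linarith [hs.1]
    exact this.ne'
  obtain ⟨C, hC⟩ := isCompact_Icc.exists_bound_of_continuousOn hcont
  exact ⟨C, fun s hs => hC s (abs_le.1 hs)⟩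

theorem eventually_forall_abs_mul_le {X : Type*} {k : X → ℝ} {M : ℝ} (hk : ∀ x, |k x| ≤ M) :
    ∀ᶠ t : ℝ in 𝓝 0, ∀ x, |t * k x| ≤ 1 / 2 := by
  have h : Tendsto (fun t : ℝ => |t| * M) (𝓝 0) (𝓝 0) := by
    have : Continuous fun t : ℝ => |t| * M := by fun_prop
    simpa using this.tendsto 0
  filter_upwards [h.eventually (ge_mem_nhds (by norm_num : (0 : ℝ) < 1 / 2))] with t ht x
  rw [abs_mul]
  exact (mul_le_mul_of_nonneg_left (hk x) (abs_nonneg t)).trans ht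

theorem integrable_mul_one_add_rpow {w k : Ω → ℝ} {t : ℝ} (p : ℝ) (hw : Integrable w μ)
    (hkm : Measurable k) (hk : ∀ x, |t * k x| ≤ 1 / 2) :
    Integrable (fun x => w x * (1 + t * k x) ^ p) μ := by
  obtain ⟨C, hC⟩ := exists_bound_one_add_rpow p
  exact hw.mul_bdd (c := C) ((measurable_const.add (hkm.const_mul t)).pow_const p).aestronglyMeasurable
    (Eventually.of_forall fun x => hC _ (hk x))

theorem tendsto_integral_mul_one_add_rpow {w k : Ω → ℝ} {M : ℝ} (p : ℝ) (hw : Integrable w μ)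
    (hkm : Measurable k) (hk : ∀ x, |k x| ≤ M) :
    Tendsto (fun t : ℝ => ∫ x, w x * (1 + t * k x) ^ p ∂μ) (𝓝 0) (𝓝 (∫ x, w x ∂μ)) := by
  obtain ⟨C, hC⟩ := exists_bound_one_add_rpow p
  refine tendsto_integral_filter_of_dominated_convergence (fun x => ‖w x‖ * C) ?_ ?_
    (hw.norm.mul_const C) ?_
  · filter_upwards [eventually_forall_abs_mul_le hk] with t ht
    exact (integrable_mul_one_add_rpow p hw hkm ht).aestronglyMeasurable
  · filter_upwards [eventually_forall_abs_mul_le hk] with t ht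
    refine Eventually.of_forall fun x => ?_
    rw [norm_mul]
    exact mul_le_mul_of_nonneg_left (hC _ (ht x)) (norm_nonneg _)
  · refine Eventually.of_forall fun x => ?_
    have hc : ContinuousAt (fun t : ℝ => w x * (1 + t * k x) ^ p) 0 := by
      refine continuousAt_const.mul (ContinuousAt.rpow_const (by fun_prop) (Or.inl (by simp)))
    simpa using hc.tendsto

/-! ### Test functions -/

/-- Directions of perturbation relative to a pair of functions `a`, `b`: measurable functions `k`
such that `k`, `a * k` and `b * k` are bounded, the three bounds being encoded as one. -/
structure IsTestFunction (a b k : Ω → ℝ) : Prop where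
  measurable : Measurable k
  bounded : ∃ M : ℝ, ∀ x, |k x| * (1 + |a x| + |b x|) ≤ M

namespace IsTestFunction

variable {a b k k' : Ω → ℝ}

theorem add_mul (hk : IsTestFunction a b k) (hk' : IsTestFunction a b k') (s : ℝ) :
    IsTestFunction a b (fun x => k x + s * k' x) := by
  obtain ⟨M, hM⟩ := hk.bounded
  obtain ⟨M', hM'⟩ := hk'.bounded
  refine ⟨hk.measurable.add (hk'.measurable.const_mul s), M + |s| * M', fun x => ?_⟩
  have hpos : 0 ≤ 1 + |a x| + |b x| := by positivity
  calc |k x + s * k' x| * (1 + |a x| + |b x|)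
      ≤ (|k x| + |s| * |k' x|) * (1 + |a x| + |b x|) := by
        rw [← abs_mul]
        exact mul_le_mul_of_nonneg_right (abs_add_le _ _) hpos
    _ = |k x| * (1 + |a x| + |b x|) + |s| * (|k' x| * (1 + |a x| + |b x|)) := by ring
    _ ≤ M + |s| * M' :=
        add_le_add (hM x) (mul_le_mul_of_nonneg_left (hM' x) (abs_nonneg s))

theorem const_mul (hk : IsTestFunction a b k) (s : ℝ) :
    IsTestFunction a b (fun x => s * k x) := by
  have h0 : IsTestFunction a b (fun _ => 0) := ⟨measurable_const, 0, by simp⟩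
  simpa using h0.add_mul hk s

theorem exists_abs_le (hk : IsTestFunction a b k) : ∃ M : ℝ, ∀ x, |k x| ≤ M := by
  obtain ⟨M, hM⟩ := hk.bounded
  refine ⟨M, fun x => le_trans (le_mul_of_one_le_right (abs_nonneg _) ?_) (hM x)⟩
  linarith [abs_nonneg (a x), abs_nonneg (b x)]

/-- A test function is integrable against any function controlled by `1 + |a| + |b|`. -/
theorem integrable_mul_mul {c g : Ω → ℝ} {C : ℝ} (hk : IsTestFunction a b k)
    (hc : Measurable c) (hcC : ∀ x, |c x| ≤ C * (1 + |a x| + |b x|)) (hg : Integrable g μ) :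
    Integrable (fun x => c x * k x * g x) μ := by
  obtain ⟨M, hM⟩ := hk.bounded
  refine hg.bdd_mul (c := |C| * M) (hc.mul hk.measurable).aestronglyMeasurable
    (Eventually.of_forall fun x => ?_)
  have hpos : 0 ≤ 1 + |a x| + |b x| := by positivity
  rw [norm_mul, Real.norm_eq_abs, Real.norm_eq_abs]
  calc |c x| * |k x| ≤ |C| * (1 + |a x| + |b x|) * |k x| :=
        mul_le_mul_of_nonneg_right ((hcC x).trans
          (mul_le_mul_of_nonneg_right (le_abs_self C) hpos)) (abs_nonneg _)
    _ = |C| * (|k x| * (1 + |a x| + |b x|)) := by ring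
    _ ≤ |C| * M := mul_le_mul_of_nonneg_left (hM x) (abs_nonneg C)

end IsTestFunction

/-! ### The abstract multiplier rule -/

section Multipliers

variable {a b c g : Ω → ℝ}

theorem abs_one_le_weight {X : Type*} (a b : X → ℝ) (x : X) :
    |(1 : ℝ)| ≤ 1 * (1 + |a x| + |b x|) := by
  rw [abs_one]
  linarith [abs_nonneg (a x), abs_nonneg (b x)]

theorem abs_left_le_weight {X : Type*} (a b : X → ℝ) (x : X) : |a x| ≤ 1 * (1 + |a x| + |b x|) := by
  linarith [abs_nonneg (a x), abs_nonneg (b x)]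

theorem abs_right_le_weight {X : Type*} (a b : X → ℝ) (x : X) : |b x| ≤ 1 * (1 + |a x| + |b x|) := by
  linarith [abs_nonneg (a x), abs_nonneg (b x)]

/-- The fundamental lemma of the calculus of variations in the form used here: a function that is
orthogonal to all test functions of mean zero is constant. -/
theorem ae_eq_const_of_integral_testFunction_eq_zero {C : ℝ} (hg : IsPosDensity μ g)
    (ha : Measurable a) (hb : Measurable b) (hc : Measurable c)
    (hcC : ∀ x, |c x| ≤ C * (1 + |a x| + |b x|))
    (H : ∀ k, IsTestFunction a b k → ∫ x, 1 * k x * g x ∂μ = 0 → ∫ x, c x * k x * g x ∂μ = 0) :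
    ∃ m : ℝ, ∀ᵐ x ∂μ, c x = m := by
  -- With weight `W = (1 + |a| + |b|)⁻¹` and `m` the mean of `c` for the weight `W ^ 2`, the test
  -- function `W ^ 2 * (c - m)` has mean zero, and pairs with `c` to the variance of `c`.
  set W : Ω → ℝ := fun x => (1 + |a x| + |b x|)⁻¹ with hW
  have hpos : ∀ x, 0 < 1 + |a x| + |b x| := fun x => by positivity
  have hWpos : ∀ x, 0 < W x := fun x => inv_pos.2 (hpos x)
  have hWm : Measurable W := ((measurable_const.add ha.abs).add hb.abs).inv
  have hW1 : ∀ x, W x ≤ 1 := fun x =>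
    inv_le_one_of_one_le₀ (by linarith [abs_nonneg (a x), abs_nonneg (b x)])
  have hWW : ∀ x, W x * (1 + |a x| + |b x|) = 1 := fun x => inv_mul_cancel₀ (hpos x).ne'
  have htest : ∀ m : ℝ, IsTestFunction a b (fun x => W x ^ 2 * (c x - m)) := by
    intro m
    refine ⟨(hWm.pow_const 2).mul (hc.sub_const m), C + |m|, fun x => ?_⟩
    rw [abs_mul, abs_of_nonneg (sq_nonneg (W x))]
    calc W x ^ 2 * |c x - m| * (1 + |a x| + |b x|)
        = W x * |c x - m| * (W x * (1 + |a x| + |b x|)) := by ring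
      _ = W x * |c x - m| := by rw [hWW, mul_one]
      _ ≤ W x * (C * (1 + |a x| + |b x|) + |m|) :=
          mul_le_mul_of_nonneg_left ((abs_sub _ _).trans (by linarith [hcC x])) (hWpos x).le
      _ = C * (W x * (1 + |a x| + |b x|)) + W x * |m| := by ring
      _ ≤ C + |m| := by
          rw [hWW, mul_one]
          linarith [mul_le_mul_of_nonneg_right (hW1 x) (abs_nonneg m)]
  have hWtest : IsTestFunction a b (fun x => W x ^ 2) := by
    refine ⟨hWm.pow_const 2, 1, fun x => ?_⟩
    rw [abs_of_nonneg (sq_nonneg (W x)), sq, mul_assoc, hWW, mul_one]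
    exact hW1 x
  have iW := hWtest.integrable_mul_mul measurable_const (abs_one_le_weight a b) hg.integrable
  have iW0 := (htest 0).integrable_mul_mul measurable_const (abs_one_le_weight a b) hg.integrable
  have hIW : 0 < ∫ x, 1 * W x ^ 2 * g x ∂μ := by
    have hnn : 0 ≤ᵐ[μ] fun x => 1 * W x ^ 2 * g x := by
      filter_upwards [hg.pos] with x hx
      positivity
    refine lt_of_le_of_ne (integral_nonneg_of_ae hnn) fun h0 => ?_
    have hz := (integral_eq_zero_iff_of_nonneg_ae hnn iW).1 h0.symm
    have : ∫ x, g x ∂μ = 0 := by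
      refine integral_eq_zero_of_ae ?_
      filter_upwards [hz, hg.pos] with x hx hp
      have : 0 < 1 * W x ^ 2 * g x := by
        have := hWpos x
        positivity
      exact absurd hx this.ne'
    rw [hg.integral_eq_one] at this
    exact one_ne_zero this
  set m : ℝ := (∫ x, 1 * (W x ^ 2 * (c x - 0)) * g x ∂μ) / ∫ x, 1 * W x ^ 2 * g x ∂μ with hm
  have hmean : ∫ x, 1 * (W x ^ 2 * (c x - m)) * g x ∂μ = 0 := by
    have e : (fun x => 1 * (W x ^ 2 * (c x - m)) * g x)
        = fun x => 1 * (W x ^ 2 * (c x - 0)) * g x - m * (1 * W x ^ 2 * g x) := by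
      funext x
      ring
    rw [e, integral_sub iW0 (iW.const_mul m), integral_const_mul, hm,
      div_mul_cancel₀ _ hIW.ne', sub_self]
  have hpair := H _ (htest m) hmean
  have ic := (htest m).integrable_mul_mul hc hcC hg.integrable
  have i1 := (htest m).integrable_mul_mul measurable_const (abs_one_le_weight a b) hg.integrable
  have hvar : ∫ x, (W x * (c x - m)) ^ 2 * g x ∂μ = 0 := by
    have e : (fun x => (W x * (c x - m)) ^ 2 * g x)
        = fun x => c x * (W x ^ 2 * (c x - m)) * g x
          - m * (1 * (W x ^ 2 * (c x - m)) * g x) := by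
      funext x
      ring
    rw [e, integral_sub ic (i1.const_mul m), integral_const_mul, hpair, hmean]
    simp
  have ivar : Integrable (fun x => (W x * (c x - m)) ^ 2 * g x) μ := by
    refine (ic.sub (i1.const_mul m)).congr (Eventually.of_forall fun x => ?_)
    simp only [Pi.sub_apply]
    ring
  have hz := (integral_eq_zero_iff_of_nonneg_ae (by
    filter_upwards [hg.pos] with x hx
    positivity) ivar).1 hvar
  refine ⟨m, ?_⟩
  filter_upwards [hz, hg.pos] with x hx hp
  have h1 : (W x * (c x - m)) ^ 2 * g x = 0 := hx
  rw [mul_eq_zero, or_iff_left hp.ne', sq_eq_zero_iff, mul_eq_zero, or_iff_right (hWpos x).ne'] at h1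
  exact sub_eq_zero.1 h1

theorem integral_testFunction_add_mul {C : ℝ} {k k' : Ω → ℝ} (hg : IsPosDensity μ g)
    (hc : Measurable c) (hcC : ∀ x, |c x| ≤ C * (1 + |a x| + |b x|))
    (hk : IsTestFunction a b k) (hk' : IsTestFunction a b k') (s : ℝ) :
    ∫ x, c x * (k x + s * k' x) * g x ∂μ
      = ∫ x, c x * k x * g x ∂μ + s * ∫ x, c x * k' x * g x ∂μ := by
  rw [← integral_const_mul, ← integral_add (hk.integrable_mul_mul hc hcC hg.integrable)
    ((hk'.integrable_mul_mul hc hcC hg.integrable).const_mul s)]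
  refine integral_congr_ae (Eventually.of_forall fun x => ?_)
  simp only
  ring

theorem integral_testFunction_const_mul (k : Ω → ℝ) (s : ℝ) :
    ∫ x, c x * (s * k x) * g x ∂μ = s * ∫ x, c x * k x * g x ∂μ := by
  rw [← integral_const_mul]
  refine integral_congr_ae (Eventually.of_forall fun x => ?_)
  simp only
  ring

/-- The first-order condition without an active constraint. -/
theorem ae_eq_const_of_integral_testFunction_nonpos (hg : IsPosDensity μ g)
    (ha : Measurable a) (hb : Measurable b)
    (H : ∀ k, IsTestFunction a b k → ∫ x, 1 * k x * g x ∂μ = 0 → ∫ x, a x * k x * g x ∂μ ≤ 0) :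
    ∃ m : ℝ, ∀ᵐ x ∂μ, a x = m := by
  refine ae_eq_const_of_integral_testFunction_eq_zero hg ha hb ha (abs_left_le_weight a b)
    fun k hk hk1 => le_antisymm (H k hk hk1) ?_
  have h := H _ (hk.const_mul (-1)) (by rw [integral_testFunction_const_mul, hk1, mul_zero])
  rw [integral_testFunction_const_mul] at h
  linarith

/-- The Lagrange multiplier rule for one inequality constraint: if `a` does not increase along any
mean-zero direction along which `b` strictly decreases, and there is such a direction since `b`
is not constant, then `a` is an affine function of `b` with nonnegative slope. -/
theorem exists_affine_of_integral_testFunction_nonpos (hg : IsPosDensity μ g)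
    (ha : Measurable a) (hb : Measurable b) (hbc : ¬ ∃ m : ℝ, ∀ᵐ x ∂μ, b x = m)
    (H : ∀ k, IsTestFunction a b k → ∫ x, 1 * k x * g x ∂μ = 0 →
      ∫ x, b x * k x * g x ∂μ < 0 → ∫ x, a x * k x * g x ∂μ ≤ 0) :
    ∃ lam m : ℝ, 0 ≤ lam ∧ ∀ᵐ x ∂μ, a x = m + lam * b x := by
  obtain ⟨k₀, hk₀, hk₀1, hk₀b⟩ : ∃ k, IsTestFunction a b k ∧ ∫ x, 1 * k x * g x ∂μ = 0 ∧
      ∫ x, b x * k x * g x ∂μ = -1 := by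
    by_contra hcon
    refine hbc (ae_eq_const_of_integral_testFunction_eq_zero hg ha hb hb
      (abs_right_le_weight a b) fun k hk hk1 => ?_)
    by_contra hne
    refine hcon ⟨_, hk.const_mul (-(∫ x, b x * k x * g x ∂μ)⁻¹), ?_, ?_⟩
    · rw [integral_testFunction_const_mul, hk1, mul_zero]
    · rw [integral_testFunction_const_mul, neg_mul, inv_mul_cancel₀ hne]
  have add1 : ∀ {k k' : Ω → ℝ} (_ : IsTestFunction a b k) (_ : IsTestFunction a b k') (s : ℝ),
      _ := fun hk hk' s => integral_testFunction_add_mul hg measurable_const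
        (abs_one_le_weight a b) hk hk' s
  have adda : ∀ {k k' : Ω → ℝ} (_ : IsTestFunction a b k) (_ : IsTestFunction a b k') (s : ℝ),
      _ := fun hk hk' s => integral_testFunction_add_mul hg ha (abs_left_le_weight a b) hk hk' s
  have addb : ∀ {k k' : Ω → ℝ} (_ : IsTestFunction a b k) (_ : IsTestFunction a b k') (s : ℝ),
      _ := fun hk hk' s => integral_testFunction_add_mul hg hb (abs_right_le_weight a b) hk hk' s
  -- Tilting by a small multiple of `k₀` extends `H` to directions along which `b` is stationary.
  have hker : ∀ k, IsTestFunction a b k → ∫ x, 1 * k x * g x ∂μ = 0 →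
      ∫ x, b x * k x * g x ∂μ = 0 → ∫ x, a x * k x * g x ∂μ ≤ 0 := by
    intro k hk hk1 hkb
    have hδ : ∀ δ : ℝ, 0 < δ →
        ∫ x, a x * k x * g x ∂μ + δ * ∫ x, a x * k₀ x * g x ∂μ ≤ 0 := by
      intro δ hδ
      rw [← adda hk hk₀ δ]
      refine H _ (hk.add_mul hk₀ δ) ?_ ?_
      · rw [add1 hk hk₀ δ, hk1, hk₀1]
        ring
      · rw [addb hk hk₀ δ, hkb, hk₀b]
        linarith
    have hlim : Tendsto (fun δ : ℝ => ∫ x, a x * k x * g x ∂μ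
        + δ * ∫ x, a x * k₀ x * g x ∂μ) (𝓝[>] 0) (𝓝 (∫ x, a x * k x * g x ∂μ)) := by
      have : Continuous fun δ : ℝ => ∫ x, a x * k x * g x ∂μ
        + δ * ∫ x, a x * k₀ x * g x ∂μ := by fun_prop
      simpa using (this.tendsto 0).mono_left nhdsWithin_le_nhds
    exact le_of_tendsto hlim (by
      filter_upwards [self_mem_nhdsWithin] with δ h using hδ δ h)
  have hker0 : ∀ k, IsTestFunction a b k → ∫ x, 1 * k x * g x ∂μ = 0 →
      ∫ x, b x * k x * g x ∂μ = 0 → ∫ x, a x * k x * g x ∂μ = 0 := by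
    intro k hk hk1 hkb
    refine le_antisymm (hker k hk hk1 hkb) ?_
    have h := hker _ (hk.const_mul (-1))
      (by rw [integral_testFunction_const_mul, hk1, mul_zero])
      (by rw [integral_testFunction_const_mul, hkb, mul_zero])
    rw [integral_testFunction_const_mul] at h
    linarith
  set lam : ℝ := -∫ x, a x * k₀ x * g x ∂μ with hlam
  have hdom : ∀ x, |a x + -lam * b x| ≤ (1 + |lam|) * (1 + |a x| + |b x|) := by
    intro x
    refine (abs_add_le _ _).trans ?_
    rw [abs_mul, abs_neg]
    nlinarith [abs_nonneg (a x), abs_nonneg (b x), abs_nonneg lam,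
      mul_nonneg (abs_nonneg lam) (abs_nonneg (a x))]
  obtain ⟨m, hm⟩ := ae_eq_const_of_integral_testFunction_eq_zero hg ha hb
    (ha.add (hb.const_mul (-lam))) hdom fun k hk hk1 => by
      set s : ℝ := ∫ x, b x * k x * g x ∂μ with hs
      have h := hker0 _ (hk.add_mul hk₀ s)
        (by rw [add1 hk hk₀ s, hk1, hk₀1]; ring) (by rw [addb hk hk₀ s, hk₀b, ← hs]; ring)
      rw [adda hk hk₀ s] at h
      have ia := hk.integrable_mul_mul ha (abs_left_le_weight a b) hg.integrable
      have ib := hk.integrable_mul_mul hb (abs_right_le_weight a b) hg.integrable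
      have e : ∫ x, (a x + -lam * b x) * k x * g x ∂μ
          = ∫ x, a x * k x * g x ∂μ + -lam * s := by
        rw [hs, ← integral_const_mul, ← integral_add ia (ib.const_mul _)]
        refine integral_congr_ae (Eventually.of_forall fun x => ?_)
        simp only
        ring
      refine e.trans ?_
      rw [hlam]
      linarith
  refine ⟨lam, m, ?_, ?_⟩
  · have := H k₀ hk₀ hk₀1 (by rw [hk₀b]; norm_num)
    rw [hlam]
    linarith
  · filter_upwards [hm] with x hx
    have h : a x + -lam * b x = m := hx
    linarith

end Multipliers

end

/-! ### Necessity of the multiplier conditions for one density -/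

section

variable {Ω : Type*} [MeasurableSpace Ω] {μ : Measure Ω}

theorem measurable_alphaDivSlope {α : ℝ} {g f : Ω → ℝ} (hg : Measurable g) (hf : Measurable f) :
    Measurable fun x => alphaDivSlope α (g x) (f x) :=
  (measurable_const.sub ((hg.div hf).pow_const _)).div_const _

/-- The slope of the divergence at a multiplicatively perturbed density. -/
theorem alphaDivSlope_mul_one_add {α g f y : ℝ} (h1 : α ≠ 1) (hg : 0 < g) (hf : 0 < f)
    (hy : 0 < y) :
    alphaDivSlope α (g * y) f
      = 1 / (1 - α) - (1 / (1 - α) - alphaDivSlope α g f) * y ^ (α - 1) := by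
  have h1' : 1 - α ≠ 0 := sub_ne_zero.2 h1.symm
  unfold alphaDivSlope
  rw [mul_div_right_comm, Real.mul_rpow (div_pos hg hf).le hy.le]
  field_simp
  ring

/-- Multiplicative perturbations `g (1 + t k)` of a density along a direction of mean zero. -/
theorem IsPosDensity.mul_one_add {g k : Ω → ℝ} {t : ℝ} (hg : IsPosDensity μ g)
    (hkm : Measurable k) (hk : ∀ x, |t * k x| ≤ 1 / 2)
    (ik : Integrable (fun x => 1 * k x * g x) μ) (hk1 : ∫ x, 1 * k x * g x ∂μ = 0) :
    IsPosDensity μ (fun x => g x * (1 + t * k x)) := by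
  have e : (fun x => g x * (1 + t * k x)) = fun x => g x + t * (1 * k x * g x) := by
    funext x
    ring
  refine ⟨hg.measurable.mul (measurable_const.add (hkm.const_mul t)), ?_, ?_, ?_⟩
  · filter_upwards [hg.pos] with x hx
    exact mul_pos hx (by linarith [(abs_le.1 (hk x)).1])
  · rw [e]
    exact hg.integrable.add (ik.const_mul t)
  · rw [e, integral_add hg.integrable (ik.const_mul t), integral_const_mul, hk1,
      hg.integral_eq_one, mul_zero, add_zero]

/-- Perturbed densities stay in the divergence class as soon as the first-order bound on their
divergence, with the slope taken at the perturbed density, stays below the radius. -/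
theorem mul_one_add_mem_alphaClass {α ε t : ℝ} (h0 : α ≠ 0) (h1 : α ≠ 1) {f g k b : Ω → ℝ}
    (hf : IsPosDensity μ f) (hg : IsPosDensity μ g) (hfin : alphaDiv μ α g f ≠ ⊤)
    (hb : ∀ x, b x = alphaDivSlope α (g x) (f x)) (hkm : Measurable k)
    (hk : ∀ x, |t * k x| ≤ 1 / 2)
    (ik : Integrable (fun x => 1 * k x * g x) μ) (hk1 : ∫ x, 1 * k x * g x ∂μ = 0)
    (ib : Integrable (fun x => (1 / (1 - α) - b x) * k x * g x) μ)
    (hε : ∫ x, alphaDivIntegrand α (g x) (f x) ∂μ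
      - t * ∫ x, (1 / (1 - α) - b x) * k x * g x * (1 + t * k x) ^ (α - 1) ∂μ ≤ ε) :
    (fun x => g x * (1 + t * k x)) ∈ alphaClass μ α ε f := by
  have hh := hg.mul_one_add hkm hk ik hk1
  refine ⟨hh, ?_⟩
  have ig := hg.integrable_alphaDivIntegrand h0 h1 hf hfin
  have ip := integrable_mul_one_add_rpow (α - 1) ib hkm hk
  have i1 : Integrable (fun x => t * (1 / (1 - α)) * (1 * k x * g x)
      - t * ((1 / (1 - α) - b x) * k x * g x * (1 + t * k x) ^ (α - 1))) μ :=
    (ik.const_mul _).sub (ip.const_mul _)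
  have hle : ∀ᵐ x ∂μ, alphaDivIntegrand α (g x * (1 + t * k x)) (f x)
      ≤ alphaDivIntegrand α (g x) (f x) + (t * (1 / (1 - α)) * (1 * k x * g x)
        - t * ((1 / (1 - α) - b x) * k x * g x * (1 + t * k x) ^ (α - 1))) := by
    filter_upwards [hg.pos, hf.pos, hh.pos] with x p1 p2 p3
    have hy : 0 < 1 + t * k x := by linarith [(abs_le.1 (hk x)).1]
    have := alphaDivIntegrand_tangent_le h0 h1 p3 p1 p2
    rw [alphaDivSlope_mul_one_add h1 p1 p2 hy, ← hb] at this
    linarith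
  have hnn : ∀ᵐ x ∂μ, 0 ≤ alphaDivIntegrand α (g x * (1 + t * k x)) (f x) := by
    filter_upwards [hf.pos, hh.pos] with x p2 p3
    exact alphaDivIntegrand_nonneg h0 h1 p3 p2
  calc alphaDiv μ α (fun x => g x * (1 + t * k x)) f
      ≤ ∫⁻ x, ENNReal.ofReal (alphaDivIntegrand α (g x) (f x)
          + (t * (1 / (1 - α)) * (1 * k x * g x)
          - t * ((1 / (1 - α) - b x) * k x * g x * (1 + t * k x) ^ (α - 1)))) ∂μ :=
        lintegral_mono_ae (hle.mono fun x hx => ENNReal.ofReal_le_ofReal hx)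
    _ = ENNReal.ofReal (∫ x, alphaDivIntegrand α (g x) (f x)
          + (t * (1 / (1 - α)) * (1 * k x * g x)
          - t * ((1 / (1 - α) - b x) * k x * g x * (1 + t * k x) ^ (α - 1))) ∂μ) :=
        (ofReal_integral_eq_lintegral_ofReal (ig.add i1)
          (by filter_upwards [hle, hnn] with x h h' using h'.trans h)).symm
    _ ≤ ENNReal.ofReal ε := by
        refine ENNReal.ofReal_le_ofReal ?_
        rw [integral_add ig i1, integral_sub (ik.const_mul _) (ip.const_mul _),
          integral_const_mul, integral_const_mul, hk1]
        linarith

/-- A lower bound for the gain in affinity under a perturbation: by concavity, the slope taken at the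
perturbed density bounds it from below. -/
theorem uAffinity_add_le_uAffinity_mul_one_add {u t : ℝ} (hu : u ∈ Ioo (0 : ℝ) 1)
    {g₀ g₁ k a : Ω → ℝ} (hg₀ : IsPosDensity μ g₀) (hg₁ : IsPosDensity μ g₁)
    (ha : ∀ x, a x = (1 - u) * (g₁ x / g₀ x) ^ u) (hkm : Measurable k)
    (hk : ∀ x, |t * k x| ≤ 1 / 2)
    (hh : IsPosDensity μ (fun x => g₀ x * (1 + t * k x)))
    (ia : Integrable (fun x => a x * k x * g₀ x) μ) :
    uAffinity μ u g₀ g₁ + t * ∫ x, a x * k x * g₀ x * (1 + t * k x) ^ (-u) ∂μ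
      ≤ uAffinity μ u (fun x => g₀ x * (1 + t * k x)) g₁ := by
  have ip := integrable_mul_one_add_rpow (-u) ia hkm hk
  have i0 := hg₀.integrable_affinity hu hg₁
  unfold uAffinity
  rw [← integral_const_mul, ← integral_add i0 (ip.const_mul t)]
  refine integral_mono_ae (i0.add (ip.const_mul t)) (hh.integrable_affinity hu hg₁) ?_
  filter_upwards [hg₀.pos, hg₁.pos] with x p0 p1
  have hy : 0 < 1 + t * k x := by linarith [(abs_le.1 (hk x)).1]
  have hA : 0 ≤ g₁ x ^ u * g₀ x ^ (1 - u) := by positivity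
  have key := mul_le_mul_of_nonneg_left (one_add_mul_rpow_neg_le hu hy) hA
  rw [Real.mul_rpow p0.le hy.le]
  have e : a x * g₀ x = (1 - u) * (g₁ x ^ u * g₀ x ^ (1 - u)) := by
    rw [rpow_mul_rpow_eq_div_rpow_mul p0 p1, ha]
    ring
  have e' : t * (a x * k x * g₀ x * (1 + t * k x) ^ (-u))
      = g₁ x ^ u * g₀ x ^ (1 - u) * ((1 - u) * (1 + t * k x - 1) * (1 + t * k x) ^ (-u)) := by
    rw [show t * (a x * k x * g₀ x * (1 + t * k x) ^ (-u))
      = a x * g₀ x * (t * k x * (1 + t * k x) ^ (-u)) by ring, e]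
    ring
  rw [e']
  linarith

/-- First-order optimality: the affinity does not increase along mean-zero directions that are
admissible, either because the divergence constraint is inactive or because the divergence
strictly decreases along them. -/
theorem integral_ratio_testFunction_nonpos {α ε u : ℝ} (h0 : α ≠ 0) (h1 : α ≠ 1)
    (hu : u ∈ Ioo (0 : ℝ) 1) {f g₀ g₁ a b k : Ω → ℝ} (hf : IsPosDensity μ f)
    (hg₀ : IsPosDensity μ g₀) (hg₁ : IsPosDensity μ g₁)
    (ha : ∀ x, a x = (1 - u) * (g₁ x / g₀ x) ^ u)
    (hb : ∀ x, b x = alphaDivSlope α (g₀ x) (f x))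
    (ham : Measurable a) (hbm : Measurable b)
    (hfin : alphaDiv μ α g₀ f ≠ ⊤)
    (hφ : ∫ x, alphaDivIntegrand α (g₀ x) (f x) ∂μ ≤ ε)
    (hmax : ∀ h ∈ alphaClass μ α ε f, uAffinity μ u h g₁ ≤ uAffinity μ u g₀ g₁)
    (hk : IsTestFunction a b k) (hk1 : ∫ x, 1 * k x * g₀ x ∂μ = 0)
    (hadm : ∫ x, alphaDivIntegrand α (g₀ x) (f x) ∂μ < ε ∨ ∫ x, b x * k x * g₀ x ∂μ < 0) :
    ∫ x, a x * k x * g₀ x ∂μ ≤ 0 := by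
  obtain ⟨M, hM⟩ := hk.exists_abs_le
  have hkm := hk.measurable
  have ik := hk.integrable_mul_mul measurable_const (abs_one_le_weight a b) hg₀.integrable
  have ia := hk.integrable_mul_mul ham (abs_left_le_weight a b) hg₀.integrable
  have ib := hk.integrable_mul_mul hbm (abs_right_le_weight a b) hg₀.integrable
  have ew : (fun x => (1 / (1 - α) - b x) * k x * g₀ x)
      = fun x => 1 / (1 - α) * (1 * k x * g₀ x) - b x * k x * g₀ x := by
    funext x
    ring
  have iw : Integrable (fun x => (1 / (1 - α) - b x) * k x * g₀ x) μ := by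
    rw [ew]
    exact (ik.const_mul _).sub ib
  have hw : ∫ x, (1 / (1 - α) - b x) * k x * g₀ x ∂μ = -∫ x, b x * k x * g₀ x ∂μ := by
    rw [ew, integral_sub (ik.const_mul _) ib, integral_const_mul, hk1]
    ring
  have hlimb := tendsto_integral_mul_one_add_rpow (α - 1) iw hkm hM
  rw [hw] at hlimb
  have hbudget : ∀ᶠ t : ℝ in 𝓝[>] 0, ∫ x, alphaDivIntegrand α (g₀ x) (f x) ∂μ
      - t * ∫ x, (1 / (1 - α) - b x) * k x * g₀ x * (1 + t * k x) ^ (α - 1) ∂μ ≤ ε := by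
    rcases hadm with hlt | hneg
    · have hlim := (tendsto_const_nhds
        (x := ∫ x, alphaDivIntegrand α (g₀ x) (f x) ∂μ)).sub (tendsto_id.mul hlimb)
      rw [zero_mul, sub_zero] at hlim
      exact ((hlim.eventually (gt_mem_nhds hlt)).filter_mono nhdsWithin_le_nhds).mono
        fun t ht => ht.le
    · have hpos := hlimb.eventually (lt_mem_nhds (neg_pos.2 hneg))
      filter_upwards [hpos.filter_mono nhdsWithin_le_nhds, self_mem_nhdsWithin] with t ht ht0
      have := mul_pos ht0 ht
      linarith
  refine le_of_tendsto ((tendsto_integral_mul_one_add_rpow (-u) ia hkm hM).mono_left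
    (nhdsWithin_le_nhds (s := Ioi (0 : ℝ)))) ?_
  filter_upwards [hbudget, self_mem_nhdsWithin,
    (eventually_forall_abs_mul_le hM).filter_mono nhdsWithin_le_nhds] with t ht ht0 htk
  have hmem := mul_one_add_mem_alphaClass h0 h1 hf hg₀ hfin hb hkm htk ik hk1 iw ht
  have h := (uAffinity_add_le_uAffinity_mul_one_add hu hg₀ hg₁ ha hkm htk hmem.1 ia).trans
    (hmax _ hmem)
  exact nonpos_of_mul_nonpos_right (by linarith) (mem_Ioi.1 ht0)

/-- Lagrangian necessity for one density: a maximizer of the affinity against `g₁ ≠ g₀` exhausts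
the divergence budget and is stationary, with a strictly positive multiplier. -/
theorem exists_stationary_of_forall_uAffinity_le {α ε u : ℝ} (h0 : α ≠ 0) (h1 : α ≠ 1)
    (hε : 0 < ε) (hu : u ∈ Ioo (0 : ℝ) 1) {f g₀ g₁ : Ω → ℝ} (hf : IsPosDensity μ f)
    (hg₁ : IsPosDensity μ g₁) (hne : ¬ g₁ =ᵐ[μ] g₀) (hg₀ : g₀ ∈ alphaClass μ α ε f)
    (hmax : ∀ h ∈ alphaClass μ α ε f, uAffinity μ u h g₁ ≤ uAffinity μ u g₀ g₁) :
    alphaDiv μ α g₀ f = ENNReal.ofReal ε ∧ ∃ lam m : ℝ, 0 < lam ∧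
      ∀ᵐ x ∂μ, (1 - u) * (g₁ x / g₀ x) ^ u = m + lam * alphaDivSlope α (g₀ x) (f x) := by
  obtain ⟨hg₀, hle⟩ := hg₀
  have hfin : alphaDiv μ α g₀ f ≠ ⊤ := ne_top_of_le_ne_top ENNReal.ofReal_ne_top hle
  have hφ := hg₀.alphaDiv_eq_ofReal_integral h0 h1 hf hfin
  rw [hφ, ENNReal.ofReal_le_ofReal_iff hε.le] at hle
  set a : Ω → ℝ := fun x => (1 - u) * (g₁ x / g₀ x) ^ u with ha
  set b : Ω → ℝ := fun x => alphaDivSlope α (g₀ x) (f x) with hb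
  have ham : Measurable a := ((hg₁.measurable.div hg₀.measurable).pow_const _).const_mul _
  have hbm : Measurable b := measurable_alphaDivSlope hg₀.measurable hf.measurable
  have hu1 : 1 - u ≠ 0 := (sub_pos.2 hu.2).ne'
  have h1' : 1 - α ≠ 0 := sub_ne_zero.2 h1.symm
  have hac : ¬ ∃ m : ℝ, ∀ᵐ x ∂μ, a x = m := by
    rintro ⟨m, hm⟩
    refine hne (hg₀.ae_eq_of_div_rpow_ae_eq_const hg₁ (p := u) (c := m / (1 - u)) hu.1.ne' ?_)
    filter_upwards [hm] with x hx
    rw [eq_div_iff hu1, mul_comm]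
    exact hx
  have H := fun k => integral_ratio_testFunction_nonpos (k := k) h0 h1 hu hf hg₀ hg₁
    (fun _ => rfl) (fun _ => rfl) ham hbm hfin hle hmax
  have hact : ∫ x, alphaDivIntegrand α (g₀ x) (f x) ∂μ = ε := by
    by_contra hcon
    exact hac (ae_eq_const_of_integral_testFunction_nonpos hg₀ ham hbm
      fun k hk hk1 => H k hk hk1 (Or.inl (lt_of_le_of_ne hle hcon)))
  -- A constant slope would force `g₀ = f`, whose divergence is zero.
  have hbc : ¬ ∃ m : ℝ, ∀ᵐ x ∂μ, b x = m := by
    rintro ⟨m, hm⟩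
    have heq : g₀ =ᵐ[μ] f := by
      refine hf.ae_eq_of_div_rpow_ae_eq_const hg₀ (p := α - 1) (c := 1 - m * (1 - α))
        (sub_ne_zero.2 h1) ?_
      filter_upwards [hm] with x hx
      have hx' : (1 - (g₀ x / f x) ^ (α - 1)) / (1 - α) = m := hx
      rw [div_eq_iff h1'] at hx'
      linarith
    refine hε.ne (hact ▸ (integral_eq_zero_of_ae ?_).symm)
    filter_upwards [heq, hf.pos] with x hx p
    rw [hx, alphaDivIntegrand_self p, Pi.zero_apply]
  obtain ⟨lam, m, hlam, hlm⟩ := exists_affine_of_integral_testFunction_nonpos hg₀ ham hbm hbc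
    fun k hk hk1 hkb => H k hk hk1 (Or.inr hkb)
  refine ⟨by rw [hφ, hact], lam, m, lt_of_le_of_ne hlam fun h => hac ⟨m, ?_⟩, hlm⟩
  filter_upwards [hlm] with x hx
  rw [hx, ← h, zero_mul, add_zero]

/-! ### The coupled problem -/

/-- Stationarity of both densities, the second one with the roles of the densities and of `u` and
`1 - u` exchanged, is the parametric form. -/
theorem exists_hasLFDForm_iff {α u : ℝ} (h1 : α ≠ 1) {f₀ f₁ g₀ g₁ : Ω → ℝ}
    (hf₀ : IsPosDensity μ f₀) (hf₁ : IsPosDensity μ f₁)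
    (hg₀ : IsPosDensity μ g₀) (hg₁ : IsPosDensity μ g₁) :
    (∃ lam₀ lam₁ m₀ m₁ : ℝ, HasLFDForm μ f₀ f₁ α u lam₀ lam₁ m₀ m₁ g₀ g₁) ↔
      (∃ lam m : ℝ, 0 < lam ∧ ∀ᵐ x ∂μ,
        (1 - u) * (g₁ x / g₀ x) ^ u = m + lam * alphaDivSlope α (g₀ x) (f₀ x)) ∧
      (∃ lam m : ℝ, 0 < lam ∧ ∀ᵐ x ∂μ,
        (1 - (1 - u)) * (g₀ x / g₁ x) ^ (1 - u)
          = m + lam * alphaDivSlope α (g₁ x) (f₁ x)) := by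
  constructor
  · rintro ⟨lam₀, lam₁, m₀, m₁, H⟩
    refine ⟨⟨lam₀, m₀, H.lam₀_pos, ?_⟩, ⟨lam₁, m₁, H.lam₁_pos, ?_⟩⟩
    · filter_upwards [H.base₀_pos, H.density₀, hg₀.pos, hf₀.pos] with x hB hd p q
      rw [stationary_iff_lfdBase₀_eq h1 H.lam₀_pos]
      exact (eq_rpow_mul_iff h1 hB p q).1 hd
    · filter_upwards [H.base₁_pos, H.density₁, hg₀.pos, hg₁.pos, hf₁.pos] with x hB hd p₀ p q
      rw [stationary_iff_lfdBase₀_eq h1 H.lam₁_pos, ← lfdBase₁_eq_lfdBase₀ p₀ p]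
      exact (eq_rpow_mul_iff h1 hB p q).1 hd
  · rintro ⟨⟨lam₀, m₀, hlam₀, h₀⟩, ⟨lam₁, m₁, hlam₁, h₁⟩⟩
    have b₀ : ∀ᵐ x ∂μ, lfdBase₀ α u lam₀ m₀ (g₁ x / g₀ x) = (g₀ x / f₀ x) ^ (α - 1) :=
      h₀.mono fun x hx => (stationary_iff_lfdBase₀_eq h1 hlam₀).1 hx
    have b₁ : ∀ᵐ x ∂μ, lfdBase₁ α u lam₁ m₁ (g₁ x / g₀ x) = (g₁ x / f₁ x) ^ (α - 1) := by
      filter_upwards [h₁, hg₀.pos, hg₁.pos] with x hx p₀ p₁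
      rw [lfdBase₁_eq_lfdBase₀ p₀ p₁]
      exact (stationary_iff_lfdBase₀_eq h1 hlam₁).1 hx
    have P₀ : ∀ᵐ x ∂μ, 0 < lfdBase₀ α u lam₀ m₀ (g₁ x / g₀ x) := by
      filter_upwards [b₀, hg₀.pos, hf₀.pos] with x hx p q
      rw [hx]
      positivity
    have P₁ : ∀ᵐ x ∂μ, 0 < lfdBase₁ α u lam₁ m₁ (g₁ x / g₀ x) := by
      filter_upwards [b₁, hg₁.pos, hf₁.pos] with x hx p q
      rw [hx]
      positivity
    have d₀ : ∀ᵐ x ∂μ,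
        g₀ x = lfdBase₀ α u lam₀ m₀ (g₁ x / g₀ x) ^ (1 / (α - 1)) * f₀ x := by
      filter_upwards [b₀, P₀, hg₀.pos, hf₀.pos] with x hx hB p q
      exact (eq_rpow_mul_iff h1 hB p q).2 hx
    have d₁ : ∀ᵐ x ∂μ,
        g₁ x = lfdBase₁ α u lam₁ m₁ (g₁ x / g₀ x) ^ (1 / (α - 1)) * f₁ x := by
      filter_upwards [b₁, P₁, hg₁.pos, hf₁.pos] with x hx hB p q
      exact (eq_rpow_mul_iff h1 hB p q).2 hx
    refine ⟨lam₀, lam₁, m₀, m₁, hlam₀, hlam₁, P₀, P₁, d₀, d₁, ?_⟩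
    filter_upwards [d₀, d₁, P₀, P₁] with x e₀ e₁ p₀ p₁
    rw [Real.div_rpow p₁.le p₀.le, div_mul_div_comm, ← e₀, ← e₁]

/-- Stationary densities that exhaust their divergence budgets maximize the affinity jointly. -/
theorem uAffinity_le_of_stationary {α ε₀ ε₁ u : ℝ} (h0 : α ≠ 0) (h1 : α ≠ 1)
    (hu : u ∈ Ioo (0 : ℝ) 1) {f₀ f₁ g₀ g₁ h₀ h₁ : Ω → ℝ}
    (hf₀ : IsPosDensity μ f₀) (hf₁ : IsPosDensity μ f₁)
    (hg₀ : IsPosDensity μ g₀) (hg₁ : IsPosDensity μ g₁)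
    (st₀ : ∃ lam m : ℝ, 0 < lam ∧ ∀ᵐ x ∂μ,
      (1 - u) * (g₁ x / g₀ x) ^ u = m + lam * alphaDivSlope α (g₀ x) (f₀ x))
    (st₁ : ∃ lam m : ℝ, 0 < lam ∧ ∀ᵐ x ∂μ,
      (1 - (1 - u)) * (g₀ x / g₁ x) ^ (1 - u) = m + lam * alphaDivSlope α (g₁ x) (f₁ x))
    (hd₀ : alphaDiv μ α g₀ f₀ = ENNReal.ofReal ε₀) (hd₁ : alphaDiv μ α g₁ f₁ = ENNReal.ofReal ε₁)
    (hh₀ : h₀ ∈ alphaClass μ α ε₀ f₀) (hh₁ : h₁ ∈ alphaClass μ α ε₁ f₁) :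
    uAffinity μ u h₀ h₁ ≤ uAffinity μ u g₀ g₁ := by
  obtain ⟨lam₀, m₀, hlam₀, st₀⟩ := st₀
  obtain ⟨lam₁, m₁, hlam₁, st₁⟩ := st₁
  have hu' : 1 - u ∈ Ioo (0 : ℝ) 1 := ⟨sub_pos.2 hu.2, sub_lt_self _ hu.1⟩
  obtain ⟨i₀, l₀⟩ := integral_tangent_le_of_stationary h0 h1 hu hlam₀ hf₀ hg₀ hg₁ st₀ hd₀ hh₀
  obtain ⟨i₁, l₁⟩ := integral_tangent_le_of_stationary h0 h1 hu' hlam₁ hf₁ hg₁ hg₀ st₁ hd₁ hh₁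
  rw [uAffinity_swap] at l₁
  have hle : uAffinity μ u h₀ h₁ ≤ ∫ x, ((1 - u) * (g₁ x / g₀ x) ^ u * h₀ x
      + (1 - (1 - u)) * (g₀ x / g₁ x) ^ (1 - u) * h₁ x) ∂μ := by
    refine integral_mono_ae (hh₀.1.integrable_affinity hu hh₁.1) (i₀.add i₁) ?_
    filter_upwards [hg₀.pos, hg₁.pos, hh₀.1.pos, hh₁.1.pos] with x p₀ p₁ q₀ q₁
    have := rpow_mul_rpow_le_tangent hu q₀.le q₁.le (div_pos p₁ p₀)
    rw [div_rpow_neg_one_add p₀ p₁] at this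
    rwa [sub_sub_cancel]
  rw [integral_add i₀ i₁] at hle
  linarith

theorem solvesMaximization_iff {α ε₀ ε₁ u : ℝ} (h0 : α ≠ 0) (h1 : α ≠ 1) (hε₀ : 0 < ε₀)
    (hε₁ : 0 < ε₁) (hu : u ∈ Ioo (0 : ℝ) 1) {f₀ f₁ g₀ g₁ : Ω → ℝ}
    (hf₀ : IsPosDensity μ f₀) (hf₁ : IsPosDensity μ f₁)
    (hg₀ : IsPosDensity μ g₀) (hg₁ : IsPosDensity μ g₁) (hne : ¬ g₀ =ᵐ[μ] g₁) :
    SolvesMaximization μ (alphaClass μ α ε₀ f₀) (alphaClass μ α ε₁ f₁) u g₀ g₁ ↔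
      (∃ lam₀ lam₁ m₀ m₁ : ℝ, HasLFDForm μ f₀ f₁ α u lam₀ lam₁ m₀ m₁ g₀ g₁) ∧
        alphaDiv μ α g₀ f₀ = ENNReal.ofReal ε₀ ∧ alphaDiv μ α g₁ f₁ = ENNReal.ofReal ε₁ := by
  have hu' : 1 - u ∈ Ioo (0 : ℝ) 1 := ⟨sub_pos.2 hu.2, sub_lt_self _ hu.1⟩
  rw [exists_hasLFDForm_iff h1 hf₀ hf₁ hg₀ hg₁]
  constructor
  · intro H
    obtain ⟨d₀, st₀⟩ := exists_stationary_of_forall_uAffinity_le h0 h1 hε₀ hu hf₀ hg₁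
      (fun h => hne h.symm) H.mem₀ H.max₀
    obtain ⟨d₁, st₁⟩ := exists_stationary_of_forall_uAffinity_le h0 h1 hε₁ hu' hf₁ hg₀ hne
      H.mem₁ (fun h hh => by
        rw [uAffinity_swap, uAffinity_swap]
        exact H.max₁ h hh)
    exact ⟨⟨st₀, st₁⟩, d₀, d₁⟩
  · rintro ⟨⟨st₀, st₁⟩, d₀, d₁⟩
    have m₀ : g₀ ∈ alphaClass μ α ε₀ f₀ := ⟨hg₀, d₀.le⟩
    have m₁ : g₁ ∈ alphaClass μ α ε₁ f₁ := ⟨hg₁, d₁.le⟩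
    have J := fun {h₀ h₁ : Ω → ℝ} => uAffinity_le_of_stationary (h₀ := h₀) (h₁ := h₁)
      h0 h1 hu hf₀ hf₁ hg₀ hg₁ st₀ st₁ d₀ d₁
    exact ⟨m₀, m₁, fun h hh => J hh m₁, fun h hh => J m₀ hh⟩

/-- Coordinatewise maximizers over the two classes are joint maximizers. -/
theorem SolvesMaximization.uAffinity_le {α ε₀ ε₁ u : ℝ} (h0 : α ≠ 0) (h1 : α ≠ 1)
    (hε₀ : 0 < ε₀) (hε₁ : 0 < ε₁) (hu : u ∈ Ioo (0 : ℝ) 1) {f₀ f₁ g₀ g₁ h₀ h₁ : Ω → ℝ}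
    (hf₀ : IsPosDensity μ f₀) (hf₁ : IsPosDensity μ f₁) (hne : ¬ g₀ =ᵐ[μ] g₁)
    (H : SolvesMaximization μ (alphaClass μ α ε₀ f₀) (alphaClass μ α ε₁ f₁) u g₀ g₁)
    (hh₀ : h₀ ∈ alphaClass μ α ε₀ f₀) (hh₁ : h₁ ∈ alphaClass μ α ε₁ f₁) :
    uAffinity μ u h₀ h₁ ≤ uAffinity μ u g₀ g₁ := by
  have hg₀ := H.mem₀.1
  have hg₁ := H.mem₁.1
  obtain ⟨F, d₀, d₁⟩ := (solvesMaximization_iff h0 h1 hε₀ hε₁ hu hf₀ hf₁ hg₀ hg₁ hne).1 H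
  obtain ⟨st₀, st₁⟩ := (exists_hasLFDForm_iff h1 hf₀ hf₁ hg₀ hg₁).1 F
  exact uAffinity_le_of_stationary h0 h1 hu hf₀ hf₁ hg₀ hg₁ st₀ st₁ d₀ d₁ hh₀ hh₁
end

theorem theorem4 {Ω : Type*} [MeasurableSpace Ω] (μ : Measure Ω)
    (f₀ f₁ : Ω → ℝ) (hf₀ : IsPosDensity μ f₀) (hf₁ : IsPosDensity μ f₁)
    (α : ℝ) (hα₀ : α ≠ 0) (hα₁ : α ≠ 1)
    (ε₀ ε₁ : ℝ) (hε₀ : 0 < ε₀) (hε₁ : 0 < ε₁)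
    (g₀ g₁ : Ω → ℝ) (hg₀ : IsPosDensity μ g₀) (hg₁ : IsPosDensity μ g₁)
    (hne : ¬ g₀ =ᵐ[μ] g₁)
    (u : ℝ) (hu : u ∈ Ioo (0 : ℝ) 1) :
    -- the least favorable densities have the parametric form, and conversely
    (IsLeastFavorable μ (alphaClass μ α ε₀ f₀) (alphaClass μ α ε₁ f₁) u g₀ g₁ ↔
      (∃ lam₀ lam₁ m₀ m₁ : ℝ, HasLFDForm μ f₀ f₁ α u lam₀ lam₁ m₀ m₁ g₀ g₁) ∧
        alphaDiv μ α g₀ f₀ = ENNReal.ofReal ε₀ ∧ alphaDiv μ α g₁ f₁ = ENNReal.ofReal ε₁ ∧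
        MinimizesAffinity μ u g₀ g₁) ∧
    -- the maximization stage alone, at the given `u`
    (SolvesMaximization μ (alphaClass μ α ε₀ f₀) (alphaClass μ α ε₁ f₁) u g₀ g₁ ↔
      (∃ lam₀ lam₁ m₀ m₁ : ℝ, HasLFDForm μ f₀ f₁ α u lam₀ lam₁ m₀ m₁ g₀ g₁) ∧
        alphaDiv μ α g₀ f₀ = ENNReal.ofReal ε₀ ∧ alphaDiv μ α g₁ f₁ = ENNReal.ofReal ε₁) ∧
    -- least favorable densities are the same as saddle points of the affinity
    (IsLeastFavorable μ (alphaClass μ α ε₀ f₀) (alphaClass μ α ε₁ f₁) u g₀ g₁ ↔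
      IsAffinitySaddle μ (alphaClass μ α ε₀ f₀) (alphaClass μ α ε₁ f₁) u g₀ g₁) := by
  have hmax := solvesMaximization_iff hα₀ hα₁ hε₀ hε₁ hu hf₀ hf₁ hg₀ hg₁ hne
  refine ⟨⟨fun H => ?_, fun ⟨F, d₀, d₁, hmin⟩ => ⟨hmax.2 ⟨F, d₀, d₁⟩, hmin⟩⟩, hmax,
    ⟨fun H => ?_, fun H => ?_⟩⟩
  · obtain ⟨F, d₀, d₁⟩ := hmax.1 H.maximization
    exact ⟨F, d₀, d₁, H.minimization⟩
  · exact ⟨H.maximization.mem₀, H.maximization.mem₁, fun h₀ hh₀ h₁ hh₁ =>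
      H.maximization.uAffinity_le hα₀ hα₁ hε₀ hε₁ hu hf₀ hf₁ hne hh₀ hh₁, H.minimization⟩
  · exact ⟨⟨H.mem₀, H.mem₁, fun h hh => H.max h hh g₁ H.mem₁,
      fun h hh => H.max g₀ H.mem₀ h hh⟩, H.min⟩
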